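/- Let $R$ be an associative ring with identity, let $D(R)$ be the unbounded derived category of right $R$-modules, and let $n\ge 0$ be an integer. Let $T$ be an $n$-tilting right $R$-module, that is: (T1) there is an exact sequence $0\to P_n\to\dots\to P_1\to P_0\to T\to 0$ of right $R$-modules with all $P_i$ projective; (T2) $\operatorname{Ext}^i_R(T,T^{(\alpha)})=0$ for every $i>0$ and every cardinal $\alpha$, where $T^{(\alpha)}$ is the direct sum of $\alpha$ copies of $T$; (T3) there is an exact sequence $0\to R\to T_0\to T_1\to\dots\to T_n\to 0$ of right $R$-modules in which every $T_i$ is a direct summand of a direct sum of copies of $T$. Let $\mathrm{Susp}_{D(R)}(T)$ be the smallest full subcategory of $D(R)$ that contains $T$ (viewed as a complex concentrated in degree $0$) and is closed under isomorphisms, extensions, positive shifts, and set-indexed direct sums. Here closed under extensions means that if $A\to B\to C\to A[1]$ is a distinguished triangle with $A$ and $C$ in the subcategory, then $B$ is in it. Then $$\mathrm{Susp}_{D(R)}(T)=\{A\in D(R) \mid \operatorname{Hom}_{D(R)}(T,A[j])=0 \text{ for all } j>0\}.$$ -/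

import Mathlib

open CategoryTheory CategoryTheory.Limits CategoryTheory.Pretriangulated

universe w u

namespace TiltingAisle

section Triangulated

variable {C : Type*} [Category C] [HasZeroObject C] [Preadditive C] [HasShift C ℤ]
  [∀ n : ℤ, (shiftFunctor C n).Additive] [Pretriangulated C]

/-- A (strictly full) subcategory of a triangulated category, given by a property `P` of objects,
is suspended if it is closed under isomorphisms, under extensions (if `A ⟶ B ⟶ C ⟶ A⟦1⟧` is
distinguished and `A`, `C` satisfy `P`, then so does `B`) and under positive shifts. -/
structure IsSuspended (P : ObjectProperty C) : Prop where
  iso : P.IsClosedUnderIsomorphisms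
  ext : P.IsTriangulatedClosed₂
  shift : ∀ j : ℤ, 0 < j → P.IsStableUnderShiftBy j

end Triangulated

section Modules

variable {R : Type u} [Ring R]

/-- The derived category `D(R)` of right `R`-modules; these are the modules over the opposite
ring. -/
abbrev D (R : Type u) [Ring R] [HasDerivedCategory.{w} (ModuleCat.{u} Rᵐᵒᵖ)] :=
  DerivedCategory (ModuleCat.{u} Rᵐᵒᵖ)

/-- `susp E` is the smallest suspended subcategory of `D(R)` which is closed under set-indexed
direct sums (coproducts in `D(R)`) and contains `E`. -/
def susp [HasDerivedCategory.{w} (ModuleCat.{u} Rᵐᵒᵖ)] (E : D.{w} R) :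
    ObjectProperty (D.{w} R) := fun X =>
  ∀ P : ObjectProperty (D.{w} R), IsSuspended P →
    (∀ J : Type u, P.IsClosedUnderColimitsOfShape (Discrete J)) → P E → P X

/-- The direct sum `T^(ι)` of copies of a right `R`-module `T`. -/
noncomputable abbrev copower (T : ModuleCat.{u} Rᵐᵒᵖ) (ι : Type u) : ModuleCat.{u} Rᵐᵒᵖ :=
  ModuleCat.of Rᵐᵒᵖ (ι →₀ T)

/-- `M` is a direct summand of a direct sum of copies of `T`. -/
def IsSummandOfCopower (T M : ModuleCat.{u} Rᵐᵒᵖ) : Prop :=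
  ∃ (ι : Type u) (N : ModuleCat.{u} Rᵐᵒᵖ), Nonempty ((M × N) ≃ₗ[Rᵐᵒᵖ] copower T ι)

/-- `0 ⟶ S₀ ⟶ S₁ ⟶ ⋯ ⟶ Sₙ ⟶ Sₙ₊₁ ⟶ 0` is an exact sequence of right `R`-modules. -/
structure IsExactWithZeros {n : ℕ} (S : ComposableArrows (ModuleCat.{u} Rᵐᵒᵖ) (n + 1)) :
    Prop where
  exact : S.Exact
  mono : Mono (S.map' 0 1)
  epi : Epi (S.map' n (n + 1))

/-- A right `R`-module `T` is `n`-tilting. -/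
structure IsTilting (n : ℕ) (T : ModuleCat.{u} Rᵐᵒᵖ) : Prop where
  /-- There is an exact sequence `0 ⟶ Pₙ ⟶ ⋯ ⟶ P₀ ⟶ T ⟶ 0` with all `Pᵢ` projective. -/
  resolution : ∃ S : ComposableArrows (ModuleCat.{u} Rᵐᵒᵖ) (n + 1), IsExactWithZeros S ∧
    (∀ i : Fin (n + 1), Projective (S.obj i.castSucc)) ∧
    Nonempty (S.obj (Fin.last (n + 1)) ≅ T)
  /-- `Extⁱ(T, T^(ι)) = 0` for all `i > 0` and all sets `ι`. -/
  ext_eq_zero : ∀ i : ℕ, 0 < i → ∀ (ι : Type u) (e : Abelian.Ext.{u} T (copower T ι) i), e = 0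
  /-- There is an exact sequence `0 ⟶ R ⟶ T₀ ⟶ ⋯ ⟶ Tₙ ⟶ 0` where every `Tᵢ` is a direct summand
  of a direct sum of copies of `T`. -/
  coresolution : ∃ S : ComposableArrows (ModuleCat.{u} Rᵐᵒᵖ) (n + 1), IsExactWithZeros S ∧
    Nonempty (S.obj 0 ≅ ModuleCat.of Rᵐᵒᵖ R) ∧
    (∀ i : Fin (n + 1), IsSummandOfCopower T (S.obj i.succ))

end Modules

end TiltingAisle

/-! Let V_k (`vanishAbove`) be the class of A with Hom(T, A[j]) = 0 for all j > k. Two facts compare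
it with the standard t-structure. Dimension shifting along the coresolution (T3) of R puts V_k
inside D^{≤ k} (`IsTilting.isLE_of_vanishAbove`). The resolution (T1) gives pd T ≤ n, so D^{≤ -n}
lies in V_0 (`IsTilting.vanishAbove_of_isLE`). By (T2), for A in V_{-k} the cone of the canonical
map to A from a coproduct of copies of T[k] lies in V_{-k-1} (`IsPresilting.exists_approximation`).

V_0 contains T and is suspended; since T need not be compact, closure under coproducts is the real
point. After n approximations the remaining objects lie in V_{-n}, hence in D^{≤ -n}. Their
coproduct is in D^{≤ -n}, hence in V_0, and extensions lead back to the original coproduct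
(`IsPresilting.vanishAbove_coproduct`).

Conversely, for A in V_0, approximating forever gives A = B_0 → B_1 → ... with B_k in D^{≤ -k}. The
telescope map of the B_k is invertible because it is unipotent on each cohomology group
(`isIso_telescope`). Comparison with the constant telescope of A by an octahedron builds A from the
cones of A → B_k, which are iterated extensions of positive shifts of copowers of T
(`prop_shift_of_isIso_telescope`). -/

namespace TiltingAisle

/-! ### Shifts of coproducts -/

section Shift

variable {C : Type*} [Category C] [HasShift C ℤ]

/-- The shift of a coproduct is a coproduct of the shifts. -/
noncomputable def isColimitShiftCofan {J : Type*} (X : J → C) [HasCoproduct X] (a : ℤ) :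
    IsColimit (Cofan.mk ((∐ X)⟦a⟧) (fun j => (Sigma.ι X j)⟦a⟧')) :=
  isColimitCofanMkObjOfIsColimit (shiftFunctor C a) X _ (coproductIsCoproduct X)

lemma exists_desc_shift {J : Type*} (X : J → C) [HasCoproduct X] (a : ℤ) {A : C}
    (φ : ∀ j, (X j)⟦a⟧ ⟶ A) : ∃ Φ : (∐ X)⟦a⟧ ⟶ A, ∀ j, (Sigma.ι X j)⟦a⟧' ≫ Φ = φ j :=
  ⟨Cofan.IsColimit.desc (isColimitShiftCofan X a) φ,
    Cofan.IsColimit.fac (isColimitShiftCofan X a) φ⟩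

lemma shift_sigma_hom_ext {J : Type*} (X : J → C) [HasCoproduct X] (a : ℤ) {A : C}
    (φ ψ : (∐ X)⟦a⟧ ⟶ A) (h : ∀ j, (Sigma.ι X j)⟦a⟧' ≫ φ = (Sigma.ι X j)⟦a⟧' ≫ ψ) : φ = ψ :=
  Cofan.IsColimit.hom_ext (isColimitShiftCofan X a) _ _ h

end Shift

/-! ### Distinguished triangles and their coproducts -/

section Triangulated

variable {C : Type*} [Category C] [HasZeroObject C] [Preadditive C] [HasShift C ℤ]
  [∀ n : ℤ, (shiftFunctor C n).Additive] [Pretriangulated C]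

section Exactness

variable {X Y Z : C} {f : X ⟶ Y} {g : Y ⟶ Z} {h : Z ⟶ X⟦(1 : ℤ)⟧}

lemma comp_eq_zero₁₂ (hT : Triangle.mk f g h ∈ distTriang C) : f ≫ g = 0 :=
  comp_distTriang_mor_zero₁₂ _ hT

lemma comp_eq_zero₃₁ (hT : Triangle.mk f g h ∈ distTriang C) : h ≫ f⟦(1 : ℤ)⟧' = 0 :=
  comp_distTriang_mor_zero₃₁ _ hT

lemma rotate_distinguished (hT : Triangle.mk f g h ∈ distTriang C) :
    Triangle.mk g h (-f⟦(1 : ℤ)⟧') ∈ distTriang C :=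
  rot_of_distTriang _ hT

lemma exists_desc₂ (hT : Triangle.mk f g h ∈ distTriang C) {A : C} (a : Y ⟶ A) (ha : f ≫ a = 0) :
    ∃ b : Z ⟶ A, a = g ≫ b :=
  Triangle.yoneda_exact₂ _ hT a ha

lemma exists_desc₃ (hT : Triangle.mk f g h ∈ distTriang C) {A : C} (a : Z ⟶ A) (ha : g ≫ a = 0) :
    ∃ b : X⟦(1 : ℤ)⟧ ⟶ A, a = h ≫ b :=
  Triangle.yoneda_exact₃ _ hT a ha

lemma exists_desc₁ (hT : Triangle.mk f g h ∈ distTriang C) {A : C} (a : X⟦(1 : ℤ)⟧ ⟶ A)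
    (ha : h ≫ a = 0) : ∃ b : Y⟦(1 : ℤ)⟧ ⟶ A, a = f⟦(1 : ℤ)⟧' ≫ b := by
  obtain ⟨b, hb⟩ := exists_desc₃ (rotate_distinguished hT) a ha
  exact ⟨-b, by rw [hb, Preadditive.neg_comp, Preadditive.comp_neg]⟩

lemma exists_lift₂ (hT : Triangle.mk f g h ∈ distTriang C) {A : C} (a : A ⟶ Y) (ha : a ≫ g = 0) :
    ∃ b : A ⟶ X, a = b ≫ f :=
  Triangle.coyoneda_exact₂ _ hT a ha

lemma exists_lift₃ (hT : Triangle.mk f g h ∈ distTriang C) {A : C} (a : A ⟶ Z) (ha : a ≫ h = 0) :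
    ∃ b : A ⟶ Y, a = b ≫ g :=
  Triangle.coyoneda_exact₃ _ hT a ha

lemma distinguished_of_iso₃ (hT : Triangle.mk f g h ∈ distTriang C) {Z' : C} (e : Z' ≅ Z)
    {g' : Y ⟶ Z'} {h' : Z' ⟶ X⟦(1 : ℤ)⟧} (hg : g' ≫ e.hom = g) (hh : h' = e.hom ≫ h) :
    Triangle.mk f g' h' ∈ distTriang C := by
  have h₁ : f ≫ 𝟙 Y = 𝟙 X ≫ f := by simp
  have h₂ : g' ≫ e.hom = 𝟙 Y ≫ g := by simp [hg]
  have h₃ : h' ≫ (𝟙 X)⟦(1 : ℤ)⟧' = e.hom ≫ h := by simp [hh]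
  exact isomorphic_distinguished _ hT _ (Triangle.isoMk _ _ (Iso.refl _) (Iso.refl _) e h₁ h₂ h₃)

end Exactness

/-- A coproduct of distinguished triangles is distinguished. -/
lemma exists_coproduct_distinguished {J : Type*} {X Y Z : J → C} (f : ∀ j, X j ⟶ Y j)
    (g : ∀ j, Y j ⟶ Z j) (h : ∀ j, Z j ⟶ (X j)⟦(1 : ℤ)⟧)
    (hT : ∀ j, Triangle.mk (f j) (g j) (h j) ∈ distTriang C)
    [HasCoproduct X] [HasCoproduct Y] [HasCoproduct Z] :
    ∃ δ, Triangle.mk (Limits.Sigma.map f) (Limits.Sigma.map g) δ ∈ distTriang C := by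
  obtain ⟨Z', f₂, f₃, hT'⟩ := distinguished_cocone_triangle (Limits.Sigma.map f)
  have hf : ∀ j, f j ≫ Sigma.ι Y j = Sigma.ι X j ≫ Limits.Sigma.map f := fun j => by simp
  have key : ∀ j, ∃ c : Z j ⟶ Z', g j ≫ c = Sigma.ι Y j ≫ f₂ ∧
      h j ≫ (Sigma.ι X j)⟦(1 : ℤ)⟧' = c ≫ f₃ := fun j =>
    complete_distinguished_triangle_morphism _ _ (hT j) hT' (Sigma.ι X j) (Sigma.ι Y j) (hf j)
  choose c hc₂ hc₃ using key
  let ψ : (∐ Z) ⟶ Z' := Sigma.desc c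
  have hψ : ∀ j, Sigma.ι Z j ≫ ψ = c j := fun j => by simp [ψ]
  have hψ₂ : Limits.Sigma.map g ≫ ψ = f₂ := Sigma.hom_ext _ _ (fun j => by simp [ψ, hc₂])
  have : IsIso ψ := by
    -- A five lemma by hand: Hom(-, A) turns coproducts into products, so the exact sequences of the
    -- given triangles can be chased componentwise.
    refine isIso_of_coyoneda_map_bijective _ (fun A => ⟨?_, ?_⟩)
    · suffices Epi ψ from fun a b h => (cancel_epi ψ).1 h
      refine Preadditive.epi_of_cancel_zero _ (fun {A} a ha => ?_)
      obtain ⟨k, rfl⟩ := exists_desc₃ hT' a (by rw [← hψ₂, Category.assoc, ha, comp_zero])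
      have h₁ : ∀ j, ∃ l : (Y j)⟦(1 : ℤ)⟧ ⟶ A,
          (Sigma.ι X j)⟦(1 : ℤ)⟧' ≫ k = (f j)⟦(1 : ℤ)⟧' ≫ l := fun j =>
        exists_desc₁ (hT j) _ (by rw [reassoc_of% (hc₃ j), ← hψ, Category.assoc, ha, comp_zero])
      choose l hl using h₁
      obtain ⟨L, hL⟩ := exists_desc_shift Y 1 l
      have h₂ : k = (Limits.Sigma.map f)⟦(1 : ℤ)⟧' ≫ L :=
        shift_sigma_hom_ext X 1 _ _ (fun j => by
          rw [hl, ← Functor.map_comp_assoc, ← hf, Functor.map_comp_assoc, hL])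
      rw [h₂, reassoc_of% (comp_eq_zero₃₁ hT'), zero_comp]
    · intro a
      obtain ⟨b, hb⟩ := exists_desc₂ hT' (Limits.Sigma.map g ≫ a) (Sigma.hom_ext _ _ (fun j => by
        simp [reassoc_of% (comp_eq_zero₁₂ (hT j))]))
      have h₁ : ∀ j, ∃ m : (X j)⟦(1 : ℤ)⟧ ⟶ A, Sigma.ι Z j ≫ (a - ψ ≫ b) = h j ≫ m := fun j =>
        exists_desc₃ (hT j) _ (by
          have h := Sigma.ι Y j ≫= hb
          rw [Sigma.ι_map_assoc] at h
          rw [Preadditive.comp_sub, Preadditive.comp_sub, reassoc_of% (hψ j), reassoc_of% (hc₂ j),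
            h, sub_self])
      choose m hm using h₁
      obtain ⟨M, hM⟩ := exists_desc_shift X 1 m
      refine ⟨b + f₃ ≫ M, ?_⟩
      change ψ ≫ (b + f₃ ≫ M) = a
      rw [Preadditive.comp_add, ← eq_sub_iff_add_eq']
      refine Sigma.hom_ext _ _ (fun j => ?_)
      rw [hm, reassoc_of% (hψ j), ← reassoc_of% (hc₃ j), hM]
  exact ⟨ψ ≫ f₃, distinguished_of_iso₃ hT' (asIso ψ) hψ₂ rfl⟩

/-- A split short exact sequence gives a distinguished triangle. -/
lemma split_distinguished {X Y Z : C} (f : X ⟶ Y) (g : Y ⟶ Z) (r : Y ⟶ X) (s : Z ⟶ Y)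
    (hfr : f ≫ r = 𝟙 X) (hfg : f ≫ g = 0) (hsr : s ≫ r = 0) (hsg : s ≫ g = 𝟙 Z)
    (total : r ≫ f + g ≫ s = 𝟙 Y) : Triangle.mk f g 0 ∈ distTriang C := by
  let e : Y ≅ X ⊞ Z :=
    { hom := biprod.lift r g
      inv := biprod.desc f s
      hom_inv_id := by simpa using total
      inv_hom_id := by ext <;> simp [*] }
  have h₁ : f ≫ e.hom = 𝟙 X ≫ biprod.inl := by
    apply biprod.hom_ext <;> simp [e, hfr, hfg]
  have h₂ : g ≫ 𝟙 Z = e.hom ≫ biprod.snd := by simp [e]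
  have h₃ : (0 : Z ⟶ X⟦(1 : ℤ)⟧) ≫ (𝟙 X)⟦(1 : ℤ)⟧' = 𝟙 Z ≫ 0 := by simp
  exact isomorphic_distinguished _ (binaryBiproductTriangle_distinguished X Z) _
    (Triangle.isoMk _ _ (Iso.refl _) e (Iso.refl _) h₁ h₂ h₃)

/-! ### Telescopes and the octahedral axiom -/

section Telescope

/-- The telescope of a constant sequence. -/
lemma const_telescope_distinguished (X : C) [HasCoproduct (fun _ : ℕ => X)] :
    Triangle.mk (Sigma.desc fun k => Sigma.ι (fun _ : ℕ => X) k - Sigma.ι (fun _ : ℕ => X) (k + 1))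
      (Sigma.desc fun _ => 𝟙 X) 0 ∈ distTriang C := by
  -- The retraction is minus the partial sums: their difference at k and k + 1 is the k-th
  -- inclusion.
  refine split_distinguished _ _
    (Sigma.desc fun k => -∑ i ∈ Finset.range k, Sigma.ι (fun _ : ℕ => X) i) (Sigma.ι (fun _ : ℕ => X) 0)
    (Sigma.hom_ext _ _ fun k => ?_) (Sigma.hom_ext _ _ fun k => ?_) ?_ ?_
    (Sigma.hom_ext _ _ fun k => ?_)
  · simp [Preadditive.sub_comp, Finset.sum_range_succ]
  · simp [Preadditive.sub_comp]
  · simp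
  · simp
  · simp only [Preadditive.comp_add, Sigma.ι_desc_assoc, Preadditive.neg_comp,
      Preadditive.sum_comp, Sigma.ι_desc, Finset.sum_range_sub', Category.id_comp,
      Category.comp_id]
    abel

variable [IsTriangulated C] (P : ObjectProperty C) [P.IsClosedUnderIsomorphisms]
  [P.IsTriangulatedClosed₂]

lemma trW_comp {X Y Z : C} {f : X ⟶ Y} {g : Y ⟶ Z} (hf : P.trW f) (hg : P.trW g) :
    P.trW (f ≫ g) := by
  obtain ⟨Z₁₂, v₁₂, w₁₂, H₁₂, mem₁₂⟩ := hf
  obtain ⟨Z₂₃, v₂₃, w₂₃, H₂₃, mem₂₃⟩ := hg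
  obtain ⟨Z₁₃, v₁₃, w₁₃, H₁₃⟩ := distinguished_cocone_triangle (f ≫ g)
  exact ⟨_, _, _, H₁₃, P.ext_of_isTriangulatedClosed₂ _
    (Triangulated.someOctahedron rfl H₁₂ H₂₃ H₁₃).mem mem₁₂ mem₂₃⟩

/-- If the telescope of a sequence starting at `A 0` vanishes, and all the cones of the maps in
the sequence satisfy `P`, then `(A 0)⟦1⟧` satisfies `P`. -/
lemma prop_shift_of_isIso_telescope [P.ContainsZero] [HasCoproductsOfShape ℕ C]
    (hshift : ∀ X, P X → P (X⟦(1 : ℤ)⟧)) (hcoprod : ∀ B : ℕ → C, (∀ k, P (B k)) → P (∐ B))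
    (A : ℕ → C) (a : ∀ k, A k ⟶ A (k + 1)) (ha : ∀ k, P.trW (a k))
    [IsIso (𝟙 (∐ A) - Sigma.desc fun k => a k ≫ Sigma.ι A (k + 1))] : P ((A 0)⟦(1 : ℤ)⟧) := by
  let c : ∀ k, A 0 ⟶ A k := fun k => Nat.rec (𝟙 _) (fun k c => c ≫ a k) k
  have hc : ∀ k, P.trW (c k) := by
    intro k
    induction k with
    | zero => exact P.trW_of_isIso (𝟙 _)
    | succ k hk => exact trW_comp P hk (ha k)
  choose B β δ hT hB using hc
  obtain ⟨δ', hT'⟩ := exists_coproduct_distinguished c β δ hT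
  let θ := asIso (𝟙 (∐ A) - Sigma.desc fun k => a k ≫ Sigma.ι A (k + 1))
  have comm : (Sigma.desc fun k => Sigma.ι (fun _ : ℕ => A 0) k - Sigma.ι (fun _ : ℕ => A 0) (k + 1))
      ≫ Limits.Sigma.map c = Limits.Sigma.map c ≫ θ.hom := by
    refine Sigma.hom_ext _ _ fun k => ?_
    have : c (k + 1) = c k ≫ a k := rfl
    simp [θ, Preadditive.sub_comp, Preadditive.comp_sub, this]
  have hT'' : Triangle.mk (Limits.Sigma.map c ≫ θ.hom) (θ.inv ≫ Limits.Sigma.map β) δ' ∈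
      distTriang C := by
    have h₁ : (Limits.Sigma.map c ≫ θ.hom) ≫ θ.inv = 𝟙 _ ≫ Limits.Sigma.map c := by simp
    have h₂ : (θ.inv ≫ Limits.Sigma.map β) ≫ 𝟙 _ = θ.inv ≫ Limits.Sigma.map β := by simp
    have h₃ : δ' ≫ (𝟙 _)⟦(1 : ℤ)⟧' = 𝟙 _ ≫ δ' := by simp
    exact isomorphic_distinguished _ hT' _
      (Triangle.isoMk _ _ (Iso.refl _) θ.symm (Iso.refl _) h₁ h₂ h₃)
  -- As θ is invertible, both `Sigma.map c` and its composite with θ have cone ∐ B. The octahedron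
  -- gives A 0 → ∐ B → ∐ B → (A 0)[1]; two rotations put (A 0)[1] between ∐ B and (∐ B)[1].
  have H := (Triangulated.someOctahedron comm (const_telescope_distinguished (A 0)) hT' hT'').mem
  exact P.ext_of_isTriangulatedClosed₂ _ (rot_of_distTriang _ (rot_of_distTriang _ H))
    (hcoprod B hB) (hshift _ (hcoprod B hB))

end Telescope

end Triangulated

/-! ### Exactness of coproducts of complexes of modules -/

section CoproductComplexes

open scoped Classical

variable {S : Type u} [Ring S] {J : Type u} (K : J → CochainComplex (ModuleCat.{u} S) ℤ)

/-- The endomorphism of a coproduct of complexes which projects to finitely many summands. -/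
noncomputable def sigmaTrunc (t : Finset J) : (∐ K) ⟶ ∐ K :=
  ∑ j ∈ t, Sigma.π K j ≫ Sigma.ι K j

lemma ι_sigmaTrunc {t : Finset J} {j : J} (hj : j ∈ t) :
    Sigma.ι K j ≫ sigmaTrunc K t = Sigma.ι K j := by
  rw [sigmaTrunc, Preadditive.comp_sum, Finset.sum_eq_single_of_mem j hj]
  · simp
  · intro k _ hk
    rw [Sigma.ι_π_of_ne_assoc K hk.symm, zero_comp]

lemma exists_sigmaTrunc_f_apply (i : ℤ) (x : (∐ K).X i) :
    ∃ t, (sigmaTrunc K t).f i x = x := by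
  let N : Submodule S ((∐ K).X i) :=
    -- Asking for all larger t' makes the condition stable under sums.
    { carrier := {x | ∃ t, ∀ t', t ⊆ t' → (sigmaTrunc K t').f i x = x}
      zero_mem' := ⟨∅, fun _ _ => map_zero _⟩
      add_mem' := by
        rintro x y ⟨t, ht⟩ ⟨u, hu⟩
        refine ⟨t ∪ u, fun v hv => ?_⟩
        rw [map_add, ht v (Finset.union_subset_left hv), hu v (Finset.union_subset_right hv)]
      smul_mem' := by
        rintro a x ⟨t, ht⟩
        exact ⟨t, fun v hv => by rw [map_smul, ht v hv]⟩ }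
  have hN : ModuleCat.ofHom N.mkQ = 0 := by
    refine Cofan.IsColimit.hom_ext (isColimitCofanMkObjOfIsColimit
      (HomologicalComplex.eval (ModuleCat.{u} S) (ComplexShape.up ℤ) i) K _
      (coproductIsCoproduct K)) _ _ (fun j => ?_)
    ext y
    have : (Sigma.ι K j).f i y ∈ N := ⟨{j}, fun t ht => by
      have := ι_sigmaTrunc K (ht (Finset.mem_singleton_self j))
      have := congr_arg (fun φ => φ.f i) this
      exact ConcreteCategory.congr_hom this y⟩
    exact (Submodule.Quotient.mk_eq_zero N).2 this
  have hx : x ∈ N := (Submodule.Quotient.mk_eq_zero N).1 (ConcreteCategory.congr_hom hN x)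
  obtain ⟨t, ht⟩ := hx
  exact ⟨t, ht t (Finset.Subset.refl t)⟩

lemma exists_homologyMap_sigmaTrunc_apply (i : ℤ) (z : (∐ K).homology i) :
    ∃ t, HomologicalComplex.homologyMap (sigmaTrunc K t) i z = z := by
  obtain ⟨c, rfl⟩ := (ModuleCat.epi_iff_surjective ((∐ K).homologyπ i)).1 inferInstance z
  obtain ⟨t, ht⟩ := exists_sigmaTrunc_f_apply K i ((∐ K).iCycles i c)
  refine ⟨t, ?_⟩
  have h₁ : HomologicalComplex.cyclesMap (sigmaTrunc K t) i c = c := by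
    apply (ModuleCat.mono_iff_injective ((∐ K).iCycles i)).1 inferInstance
    refine Eq.trans ?_ ht
    exact ConcreteCategory.congr_hom (HomologicalComplex.cyclesMap_i (sigmaTrunc K t) i) c
  have h₂ := ConcreteCategory.congr_hom
    (HomologicalComplex.homologyπ_naturality (sigmaTrunc K t) i) c
  refine h₂.trans ?_
  change (∐ K).homologyπ i (HomologicalComplex.cyclesMap (sigmaTrunc K t) i c) = _
  rw [h₁]

lemma homologyMap_sigmaTrunc (i : ℤ) (t : Finset J) :
    HomologicalComplex.homologyMap (sigmaTrunc K t) i =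
      ∑ j ∈ t, HomologicalComplex.homologyMap (Sigma.π K j) i ≫
        HomologicalComplex.homologyMap (Sigma.ι K j) i := by
  simp only [← HomologicalComplex.homologyMap_comp]
  exact (HomologicalComplex.homologyFunctor _ _ i).map_sum _ _

/-- Each class is fixed by a finite truncation, hence is a finite sum of classes from the summands.
-/
lemma homology_sigma_hom_ext (i : ℤ) {M : ModuleCat.{u} S} {φ ψ : (∐ K).homology i ⟶ M}
    (h : ∀ j, HomologicalComplex.homologyMap (Sigma.ι K j) i ≫ φ =
      HomologicalComplex.homologyMap (Sigma.ι K j) i ≫ ψ) : φ = ψ := by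
  ext z
  obtain ⟨t, ht⟩ := exists_homologyMap_sigmaTrunc_apply K i z
  have : HomologicalComplex.homologyMap (sigmaTrunc K t) i ≫ φ =
      HomologicalComplex.homologyMap (sigmaTrunc K t) i ≫ ψ := by
    simp only [homologyMap_sigmaTrunc, Preadditive.sum_comp, Category.assoc, h]
  have := ConcreteCategory.congr_hom this z
  rw [ModuleCat.comp_apply, ModuleCat.comp_apply, ht] at this
  exact this

lemma homology_sigma_eq_zero (i : ℤ) (z : (∐ K).homology i)
    (h : ∀ j, HomologicalComplex.homologyMap (Sigma.π K j) i z = 0) : z = 0 := by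
  obtain ⟨t, ht⟩ := exists_homologyMap_sigmaTrunc_apply K i z
  rw [← ht, homologyMap_sigmaTrunc]
  change ModuleCat.Hom.hom _ z = 0
  rw [ModuleCat.hom_sum, LinearMap.sum_apply]
  refine Finset.sum_eq_zero fun j _ => ?_
  change HomologicalComplex.homologyMap (Sigma.ι K j) i
    (HomologicalComplex.homologyMap (Sigma.π K j) i z) = 0
  rw [h, map_zero]

/-- Coproducts of quasi-isomorphisms are quasi-isomorphisms. -/
lemma quasiIso_sigmaMap {K L : J → CochainComplex (ModuleCat.{u} S) ℤ} (s : ∀ j, K j ⟶ L j)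
    [∀ j, QuasiIso (s j)] : QuasiIso (Limits.Sigma.map s) := by
  rw [quasiIso_iff]
  intro i
  rw [quasiIsoAt_iff_isIso_homologyMap]
  have : Mono (HomologicalComplex.homologyMap (Limits.Sigma.map s) i) := by
    rw [ModuleCat.mono_iff_injective, injective_iff_map_eq_zero]
    intro z hz
    refine homology_sigma_eq_zero K i z fun j => ?_
    apply (ModuleCat.mono_iff_injective (HomologicalComplex.homologyMap (s j) i)).1 inferInstance
    have comm : Sigma.π K j ≫ s j = Limits.Sigma.map s ≫ Sigma.π L j := by
      refine Sigma.hom_ext _ _ fun k => ?_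
      by_cases hk : k = j
      · subst hk; simp
      · simp [Sigma.ι_π_of_ne_assoc K hk, Sigma.ι_π_of_ne L hk]
    have h := congr_arg (fun φ => HomologicalComplex.homologyMap φ i) comm
    simp only [HomologicalComplex.homologyMap_comp] at h
    have h := ConcreteCategory.congr_hom h z
    rw [ModuleCat.comp_apply, ModuleCat.comp_apply, hz, map_zero] at h
    rw [h, map_zero]
  have : Epi (HomologicalComplex.homologyMap (Limits.Sigma.map s) i) := by
    refine Preadditive.epi_of_cancel_zero _ fun φ hφ => homology_sigma_hom_ext L i fun j => ?_
    rw [comp_zero, ← cancel_epi (HomologicalComplex.homologyMap (s j) i),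
      ← HomologicalComplex.homologyMap_comp_assoc, ← Sigma.ι_map,
      HomologicalComplex.homologyMap_comp_assoc, hφ, comp_zero, comp_zero]
  exact isIso_of_mono_of_epi _

end CoproductComplexes

/-! ### Coproducts in the derived category -/

section CoproductsDerived

variable {S : Type u} [Ring S] [HasDerivedCategory.{w} (ModuleCat.{u} S)] {J : Type u}

open DerivedCategory

lemma homology_Q_sigma_hom_ext (K : J → CochainComplex (ModuleCat.{u} S) ℤ) (i : ℤ)
    {M : ModuleCat.{u} S} {φ ψ : (homologyFunctor _ i).obj (Q.obj (∐ K)) ⟶ M}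
    (h : ∀ j, (homologyFunctor _ i).map (Q.map (Sigma.ι K j)) ≫ φ =
      (homologyFunctor _ i).map (Q.map (Sigma.ι K j)) ≫ ψ) : φ = ψ := by
  rw [← cancel_epi ((homologyFunctorFactors _ i).inv.app (∐ K))]
  refine homology_sigma_hom_ext K i fun j => ?_
  have := (homologyFunctorFactors (ModuleCat.{u} S) i).inv.naturality (Sigma.ι K j)
  simp only [Functor.comp_map, HomologicalComplex.homologyFunctor_map] at this
  erw [reassoc_of% this, reassoc_of% this]
  rw [h]

/-- Calculus of fractions: the denominators of the given maps assemble to a quasi-isomorphism of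
coproducts. -/
lemma exists_desc_Q_sigma (K : J → CochainComplex (ModuleCat.{u} S) ℤ)
    {Y : DerivedCategory (ModuleCat.{u} S)} (f : ∀ j, Q.obj (K j) ⟶ Y) :
    ∃ F : Q.obj (∐ K) ⟶ Y, ∀ j, Q.map (Sigma.ι K j) ≫ F = f j := by
  let e := Q.objObjPreimageIso Y
  choose K' s hs g hg using fun j => right_fac (f j ≫ e.inv)
  have : ∀ j, QuasiIso (s j) := fun j => (isIso_Q_map_iff_quasiIso _ _).1 (hs j)
  have := quasiIso_sigmaMap s
  refine ⟨inv (Q.map (Limits.Sigma.map s)) ≫ Q.map (Sigma.desc g) ≫ e.hom, fun j => ?_⟩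
  rw [← cancel_epi (Q.map (s j)), ← Q.map_comp_assoc, ← Sigma.ι_map, Q.map_comp_assoc,
    IsIso.hom_inv_id_assoc, ← Q.map_comp_assoc, Sigma.ι_desc]
  have := hg j
  rw [Iso.comp_inv_eq] at this
  rw [this, Category.assoc, IsIso.hom_inv_id_assoc]

/-- The inclusions lift to the fibre of f and glue to L. The composite of L with the fibre map is
the identity on homology, hence invertible, and f kills it. -/
lemma Q_sigma_eq_zero (K : J → CochainComplex (ModuleCat.{u} S) ℤ)
    {Y : DerivedCategory (ModuleCat.{u} S)} (f : Q.obj (∐ K) ⟶ Y)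
    (hf : ∀ j, Q.map (Sigma.ι K j) ≫ f = 0) : f = 0 := by
  obtain ⟨X, c, δ, hT⟩ := distinguished_cocone_triangle₁ f
  choose l hl using fun j => exists_lift₂ hT _ (hf j)
  obtain ⟨L, hL⟩ := exists_desc_Q_sigma K l
  have : IsIso (L ≫ c) := by
    rw [isIso_iff]
    intro i
    have : (homologyFunctor _ i).map (L ≫ c) = 𝟙 _ := by
      refine homology_Q_sigma_hom_ext K i fun j => ?_
      rw [← Functor.map_comp, ← Category.assoc, hL, ← hl, Category.comp_id]
    rw [this]
    infer_instance
  rw [← cancel_epi (L ≫ c), Category.assoc, comp_eq_zero₁₂ hT, comp_zero, comp_zero]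

/-- The localization functor to the derived category preserves coproducts. -/
noncomputable def isColimitQSigma (K : J → CochainComplex (ModuleCat.{u} S) ℤ) :
    IsColimit (Cofan.mk (Q.obj (∐ K)) (fun j => Q.map (Sigma.ι K j))) :=
  Cofan.IsColimit.mk _ (fun t => (exists_desc_Q_sigma K t.inj).choose)
    (fun t => (exists_desc_Q_sigma K t.inj).choose_spec)
    (fun t m hm => by
      rw [← sub_eq_zero]
      refine Q_sigma_eq_zero K _ fun j => ?_
      rw [Preadditive.comp_sub, (exists_desc_Q_sigma K t.inj).choose_spec j, sub_eq_zero]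
      exact hm j)

instance hasCoproductsOfShape_derivedCategory :
    HasCoproductsOfShape J (DerivedCategory (ModuleCat.{u} S)) := by
  have : ∀ X : J → DerivedCategory (ModuleCat.{u} S), HasCoproduct X := fun X => by
    have : HasCoproduct (fun j => Q.obj (Q.objPreimage (X j))) :=
      ⟨_, isColimitQSigma (fun j => Q.objPreimage (X j))⟩
    exact hasColimit_of_iso (F := Discrete.functor fun j => Q.obj (Q.objPreimage (X j)))
      (Discrete.natIso fun j => (Q.objObjPreimageIso (X j.as)).symm)
  exact ⟨fun F => hasColimit_of_iso Discrete.natIsoFunctor⟩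

/-- The homology of a coproduct is generated by the homologies of the summands. -/
lemma homology_sigma_hom_ext' (X : J → DerivedCategory (ModuleCat.{u} S)) (i : ℤ)
    {M : ModuleCat.{u} S} {φ ψ : (homologyFunctor _ i).obj (∐ X) ⟶ M}
    (h : ∀ j, (homologyFunctor _ i).map (Sigma.ι X j) ≫ φ =
      (homologyFunctor _ i).map (Sigma.ι X j) ≫ ψ) : φ = ψ := by
  let K := fun j => Q.objPreimage (X j)
  let a : ∀ j, Q.obj (K j) ≅ X j := fun j => Q.objObjPreimageIso (X j)
  let e : Q.obj (∐ K) ≅ ∐ X :=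
    (isColimitQSigma K).coconePointUniqueUpToIso (coproductIsCoproduct fun j => Q.obj (K j)) ≪≫
      Sigma.mapIso a
  have he : ∀ j, Q.map (Sigma.ι K j) ≫ e.hom = (a j).hom ≫ Sigma.ι X j := fun j => by
    have := (isColimitQSigma K).comp_coconePointUniqueUpToIso_hom
      (coproductIsCoproduct fun j => Q.obj (K j)) ⟨j⟩
    dsimp at this
    simp only [e, Iso.trans_hom, reassoc_of% this, Sigma.ι_mapIso_hom]
  rw [← cancel_epi ((homologyFunctor _ i).map e.hom)]
  refine homology_Q_sigma_hom_ext K i fun j => ?_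
  rw [← Functor.map_comp_assoc, he, ← Functor.map_comp_assoc, he, Functor.map_comp_assoc, h,
    Functor.map_comp_assoc]

end CoproductsDerived

/-! ### Vanishing classes and triangles -/

section Vanishing

set_option linter.unusedSectionVars false

variable {C : Type*} [Category C] [HasZeroObject C] [Preadditive C] [HasShift C ℤ]
  [∀ n : ℤ, (shiftFunctor C n).Additive] [Pretriangulated C]

lemma exists_shift_distinguished {X Y Z : C} {f : X ⟶ Y} {g : Y ⟶ Z} {h : Z ⟶ X⟦(1 : ℤ)⟧}
    (hT : Triangle.mk f g h ∈ distTriang C) (n : ℤ) :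
    ∃ h', Triangle.mk (f⟦n⟧') (g⟦n⟧') h' ∈ distTriang C := by
  have H := Triangle.shift_distinguished _ hT n
  -- A sign on the middle object absorbs the signs of the first two shifted maps.
  have h₁ : f⟦n⟧' ≫ (n.negOnePow • Iso.refl (Y⟦n⟧)).hom = 𝟙 _ ≫ (n.negOnePow • f⟦n⟧') := by
    simp
  have h₂ : g⟦n⟧' ≫ 𝟙 _ = (n.negOnePow • Iso.refl (Y⟦n⟧)).hom ≫ (n.negOnePow • g⟦n⟧') := by
    simp [smul_smul]
  let δ : Z⟦n⟧ ⟶ X⟦n⟧⟦(1 : ℤ)⟧ := ((Triangle.shiftFunctor C n).obj (Triangle.mk f g h)).mor₃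
  have h₃ : δ ≫ (𝟙 (X⟦n⟧))⟦(1 : ℤ)⟧' = 𝟙 _ ≫ δ := by simp
  exact ⟨δ, isomorphic_distinguished _ H _ (Triangle.isoMk _ _ (Iso.refl _)
    (n.negOnePow • Iso.refl (Y⟦n⟧)) (Iso.refl _) h₁ h₂ h₃)⟩

/-- The objects `A` such that `Hom(E, A⟦j⟧) = 0` for all `j > k`. -/
def vanishAbove (E : C) (k : ℤ) : ObjectProperty C :=
  fun A => ∀ j : ℤ, k < j → ∀ f : E ⟶ A⟦j⟧, f = 0

variable (E : C)

lemma vanishAbove_mono {k l : ℤ} (hkl : k ≤ l) : vanishAbove E k ≤ vanishAbove E l :=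
  fun _ hA j hj f => hA j (by lia) f

lemma vanishAbove_of_retract {k : ℤ} {A B : C} (i : B ⟶ A) (r : A ⟶ B) (hir : i ≫ r = 𝟙 B)
    (hA : vanishAbove E k A) : vanishAbove E k B := fun j hj f => by
  rw [← Category.comp_id f, ← (shiftFunctor C j).map_id, ← hir, Functor.map_comp,
    ← Category.assoc, hA j hj (f ≫ i⟦j⟧'), zero_comp]

instance isClosedUnderIsomorphisms_vanishAbove (k : ℤ) :
    (vanishAbove E k).IsClosedUnderIsomorphisms where
  of_iso e hA := vanishAbove_of_retract E e.inv e.hom e.inv_hom_id hA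

lemma vanishAbove_ext {k : ℤ} {X Y Z : C} {f : X ⟶ Y} {g : Y ⟶ Z} {h : Z ⟶ X⟦(1 : ℤ)⟧}
    (hT : Triangle.mk f g h ∈ distTriang C) (hX : vanishAbove E k X) (hZ : vanishAbove E k Z) :
    vanishAbove E k Y := fun j hj a => by
  obtain ⟨h', hT'⟩ := exists_shift_distinguished hT j
  obtain ⟨b, rfl⟩ := exists_lift₂ hT' a (hZ j hj _)
  rw [hX j hj b, zero_comp]

instance isTriangulatedClosed₂_vanishAbove (k : ℤ) :
    (vanishAbove E k).IsTriangulatedClosed₂ where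
  ext₂' _ hT h₁ h₃ := ObjectProperty.le_isoClosure _ _ (vanishAbove_ext E hT h₁ h₃)

lemma vanishAbove_shift {k a l : ℤ} (hk : a + l = k) {A : C} (hA : vanishAbove E k A) :
    vanishAbove E l (A⟦a⟧) := fun j hj f => by
  rw [← cancel_mono ((shiftFunctorAdd' C a j (a + j) rfl).inv.app A), zero_comp]
  exact hA (a + j) (by lia) _

/-- If `X` has no self-extension with respect to `E` and `Hom(E, X) ⟶ Hom(E, Y)` is surjective,
then the cone of `X ⟶ Y` has one more vanishing degree. -/
lemma vanishAbove_cone {X Y Z : C} {f : X ⟶ Y} {g : Y ⟶ Z} {h : Z ⟶ X⟦(1 : ℤ)⟧}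
    (hT : Triangle.mk f g h ∈ distTriang C) (hX : vanishAbove E 0 X) (hY : vanishAbove E 0 Y)
    (hf : ∀ a : E ⟶ Y, ∃ b : E ⟶ X, b ≫ f = a) : vanishAbove E (-1) Z := by
  intro j hj a
  obtain hj | rfl : 0 < j ∨ j = 0 := by lia
  · exact vanishAbove_ext E (rotate_distinguished hT) hY
      (vanishAbove_mono E (by lia) _ (vanishAbove_shift E (l := -1) (by lia) hX)) j hj a
  · rw [← cancel_mono ((shiftFunctorZero C ℤ).hom.app Z), zero_comp]
    set a' : E ⟶ Z := a ≫ (shiftFunctorZero C ℤ).hom.app Z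
    obtain ⟨b, hb⟩ := exists_lift₃ hT a' (hX 1 one_pos _)
    obtain ⟨c, rfl⟩ := hf b
    rw [hb, Category.assoc, comp_eq_zero₁₂ hT, comp_zero]

end Vanishing

/-! ### Approximation by coproducts of E -/

section Approximation

variable {C : Type*} [Category.{w} C] [HasZeroObject C] [Preadditive C] [HasShift C ℤ]
  [∀ n : ℤ, (shiftFunctor C n).Additive] [Pretriangulated C]
  [∀ J : Type u, HasCoproductsOfShape J C] (E : C)

/-- `E` has no self-extensions with coproducts, and morphisms from `E` form small sets. -/
structure IsPresilting : Prop where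
  small (A : C) : Small.{u} (E ⟶ A)
  vanish (I : Type u) : vanishAbove E 0 (∐ fun _ : I => E)

variable {E}

/-- One copy of E for each map E ⟶ A makes the canonical map surjective on Hom(E, -). -/
lemma IsPresilting.exists_approximation_zero (hE : IsPresilting.{w, u} E) {A : C}
    (hA : vanishAbove E 0 A) : ∃ (I : Type u) (A' : C) (f : (∐ fun _ : I => E) ⟶ A)
      (g : A ⟶ A') (h : A' ⟶ (∐ fun _ : I => E)⟦(1 : ℤ)⟧),
      Triangle.mk f g h ∈ distTriang C ∧ vanishAbove E (-1) A' := by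
  have := hE.small A
  let f : (∐ fun _ : Shrink.{u} (E ⟶ A) => E) ⟶ A := Sigma.desc fun i => (equivShrink _).symm i
  obtain ⟨A', g, h, hT⟩ := distinguished_cocone_triangle f
  refine ⟨_, A', f, g, h, hT, vanishAbove_cone E hT (hE.vanish _) hA fun a =>
    ⟨Sigma.ι (fun _ : Shrink.{u} (E ⟶ A) => E) (equivShrink _ a), ?_⟩⟩
  simp [f]

lemma IsPresilting.exists_approximation (hE : IsPresilting.{w, u} E) (k : ℤ) {A : C}
    (hA : vanishAbove E (-k) A) : ∃ (I : Type u) (A' : C) (f : (∐ fun _ : I => E)⟦k⟧ ⟶ A)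
      (g : A ⟶ A') (h : A' ⟶ (∐ fun _ : I => E)⟦k⟧⟦(1 : ℤ)⟧),
      Triangle.mk f g h ∈ distTriang C ∧ vanishAbove E (-k - 1) A' := by
  obtain ⟨I, A', f, g, h, hT, hA'⟩ :=
    hE.exists_approximation_zero (vanishAbove_shift E (a := -k) (l := 0) (by lia) hA)
  obtain ⟨h', hT'⟩ := exists_shift_distinguished hT k
  let e : A⟦-k⟧⟦k⟧ ≅ A := (shiftEquiv C k).counitIso.app A
  have h₁ : (f⟦k⟧' ≫ e.hom) ≫ e.inv = 𝟙 _ ≫ f⟦k⟧' := by simp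
  have h₂ : (e.inv ≫ g⟦k⟧') ≫ 𝟙 _ = e.inv ≫ g⟦k⟧' := by simp
  have h₃ : h' ≫ (𝟙 _)⟦(1 : ℤ)⟧' = 𝟙 _ ≫ h' := by simp
  exact ⟨I, A'⟦k⟧, f⟦k⟧' ≫ e.hom, e.inv ≫ g⟦k⟧', h', isomorphic_distinguished _ hT' _
    (Triangle.isoMk _ _ (Iso.refl _) e.symm (Iso.refl _) h₁ h₂ h₃),
    vanishAbove_shift E (by lia) hA'⟩

lemma IsPresilting.vanishAbove_coproduct_shift (hE : IsPresilting.{w, u} E) {J : Type u}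
    (I : J → Type u) {k : ℤ} (hk : 0 ≤ k) :
    vanishAbove E 0 (∐ fun j => (∐ fun _ : I j => E)⟦k⟧) := by
  let e₁ : (∐ fun j => ∐ fun _ : I j => E) ≅ ∐ fun _ : Σ j, I j => E :=
    sigmaSigmaIso I fun _ _ => E
  let e₂ : (∐ fun j => (∐ fun _ : I j => E)⟦k⟧) ≅ (∐ fun j => ∐ fun _ : I j => E)⟦k⟧ :=
    (coproductIsCoproduct _).coconePointUniqueUpToIso (isColimitShiftCofan _ k)
  exact (vanishAbove E 0).prop_of_iso (e₂ ≪≫ (shiftFunctor C k).mapIso e₁).symm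
    (vanishAbove_mono E (by lia) _ (vanishAbove_shift E (l := -k) (by lia) (hE.vanish _)))

/-- If coproducts of objects with enough vanishing degrees are in `vanishAbove E 0`, then
`vanishAbove E 0` is closed under coproducts. -/
lemma IsPresilting.vanishAbove_coproduct (hE : IsPresilting.{w, u} E) {J : Type u} (n : ℕ)
    (hn : ∀ X : J → C, (∀ j, vanishAbove E (-n) (X j)) → vanishAbove E 0 (∐ X))
    (X : J → C) (hX : ∀ j, vanishAbove E 0 (X j)) : vanishAbove E 0 (∐ X) := by
  -- Here m counts the approximations still needed to reach degree -n.
  suffices ∀ (m k : ℕ), k + m = n → ∀ X : J → C, (∀ j, vanishAbove E (-k) (X j)) →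
      vanishAbove E 0 (∐ X) from this n 0 (by simp) X (by simpa using hX)
  intro m
  induction m with
  | zero => rintro k rfl X hX; exact hn X hX
  | succ m hm =>
    intro k hk X hX
    choose I X' f g h hT hX' using fun j => hE.exists_approximation k (hX j)
    obtain ⟨δ, hδ⟩ := exists_coproduct_distinguished f g h hT
    refine vanishAbove_ext E hδ (hE.vanishAbove_coproduct_shift I (by lia))
      (hm (k + 1) (by lia) X' fun j => ?_)
    have : (-(k + 1 : ℕ) : ℤ) = -k - 1 := by push_cast; ring
    rw [this]
    exact hX' j

end Approximation

/-! ### Generation of the vanishing class -/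

section Generation

variable {S : Type u} [Ring S] [HasDerivedCategory.{w} (ModuleCat.{u} S)]

open DerivedCategory

instance hasCountableCoproducts_derivedCategory :
    HasCoproductsOfShape ℕ (DerivedCategory (ModuleCat.{u} S)) :=
  hasColimitsOfShape_of_equivalence (Discrete.equivalence Equiv.ulift.{u})

lemma homology_sigma_nat_hom_ext (X : ℕ → DerivedCategory (ModuleCat.{u} S)) (i : ℤ)
    {M : ModuleCat.{u} S} {φ ψ : (homologyFunctor _ i).obj (∐ X) ⟶ M}
    (h : ∀ k, (homologyFunctor _ i).map (Sigma.ι X k) ≫ φ =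
      (homologyFunctor _ i).map (Sigma.ι X k) ≫ ψ) : φ = ψ := by
  let e : (∐ X ∘ Equiv.ulift.{u}) ≅ ∐ X := Sigma.reindex Equiv.ulift.{u} X
  rw [← cancel_epi ((homologyFunctor _ i).map e.hom)]
  refine homology_sigma_hom_ext' _ i fun j => ?_
  rw [← Functor.map_comp_assoc, ← Functor.map_comp_assoc, Sigma.ι_reindex_hom]
  exact h j.down

lemma isLE_sigma {J : Type u} (X : J → DerivedCategory (ModuleCat.{u} S)) (n : ℤ)
    (hX : ∀ j, (X j).IsLE n) : (∐ X).IsLE n := by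
  rw [isLE_iff]
  intro i hi
  rw [IsZero.iff_id_eq_zero]
  exact homology_sigma_hom_ext' X i fun j => ((X j).isZero_of_isLE n i hi).eq_of_src _ _

/-- The telescope of a sequence of increasingly connected objects vanishes. -/
lemma isIso_telescope (A : ℕ → DerivedCategory (ModuleCat.{u} S)) (a : ∀ k, A k ⟶ A (k + 1))
    (hA : ∀ k : ℕ, (A k).IsLE (-k)) :
    IsIso (𝟙 (∐ A) - Sigma.desc fun k => a k ≫ Sigma.ι A (k + 1)) := by
  let σ : End (∐ A) := Sigma.desc fun k => a k ≫ Sigma.ι A (k + 1)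
  have hσ : ∀ N k : ℕ, ∃ c : A k ⟶ A (k + N), Sigma.ι A k ≫ (σ ^ N : End (∐ A)) =
      c ≫ Sigma.ι A (k + N) := by
    intro N k
    induction N with
    | zero => exact ⟨𝟙 _, by simp [End.one_def]⟩
    | succ N hN =>
      obtain ⟨c, hc⟩ := hN
      refine ⟨c ≫ a (k + N), ?_⟩
      rw [pow_succ', End.mul_def, reassoc_of% hc]
      simp only [σ, Sigma.ι_desc, Category.assoc]
      rfl
  rw [isIso_iff]
  intro i
  have hnil : IsNilpotent ((homologyFunctor (ModuleCat.{u} S) i).mapEnd (∐ A) σ) := by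
    -- With N ≥ 1 - i, σ^N sends the k-th summand into A (k + N), which has no cohomology in degree
    -- i; the bound is uniform in k.
    refine ⟨(1 - i).toNat, ?_⟩
    rw [← map_pow]
    refine homology_sigma_nat_hom_ext A i fun k => ?_
    obtain ⟨c, hc⟩ := hσ (1 - i).toNat k
    change (homologyFunctor _ i).map (Sigma.ι A k) ≫ (homologyFunctor _ i).map (σ ^ _ : End _) = _
    rw [← Functor.map_comp, hc, Functor.map_comp]
    have := hA (k + (1 - i).toNat)
    have hz := isZero_of_isLE (A (k + (1 - i).toNat)) (-(k + (1 - i).toNat : ℕ)) i (by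
      have := Int.self_le_toNat (1 - i)
      push_cast
      lia)
    rw [hz.eq_of_tgt ((homologyFunctor _ i).map c) 0, zero_comp]
    exact comp_zero.symm
  have hunit := (isUnit_iff_isIso _).1 hnil.isUnit_one_sub
  have : (homologyFunctor (ModuleCat.{u} S) i).map
      (𝟙 (∐ A) - Sigma.desc fun k => a k ≫ Sigma.ι A (k + 1)) =
      (1 - (homologyFunctor (ModuleCat.{u} S) i).mapEnd (∐ A) σ : End _) := by
    rw [Functor.map_sub, CategoryTheory.Functor.map_id]
    rfl
  exact this ▸ hunit

variable {E : DerivedCategory (ModuleCat.{u} S)}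

lemma isLE_of_vanishAbove (hLE : ∀ A, vanishAbove E 0 A → A.IsLE 0) {k : ℤ}
    {A : DerivedCategory (ModuleCat.{u} S)} (hA : vanishAbove E k A) : A.IsLE k := by
  have := hLE _ (vanishAbove_shift E (a := k) (l := 0) (by lia) hA)
  exact TStructure.t.isLE_of_shift A k k 0

/-- A presilting object whose `vanishAbove` class lies in the standard aisle generates that
class. -/
lemma IsPresilting.prop_of_vanishAbove (hE : IsPresilting.{w, u} E)
    (hLE : ∀ A, vanishAbove E 0 A → A.IsLE 0)
    (P : ObjectProperty (DerivedCategory (ModuleCat.{u} S))) (hP : IsSuspended P)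
    (hcoprod : ∀ J : Type u, P.IsClosedUnderColimitsOfShape (Discrete J)) (hPE : P E)
    {A : DerivedCategory (ModuleCat.{u} S)} (hA : vanishAbove E 0 A) : P A := by
  have := hP.iso
  have := hP.ext
  have hshift : ∀ {k : ℤ}, 0 ≤ k → ∀ X, P X → P (X⟦k⟧) := by
    intro k hk X hX
    obtain hk | rfl := hk.lt_or_eq
    · exact (hP.shift k hk).le_shift _ hX
    · exact P.prop_of_iso ((shiftFunctorZero _ ℤ).symm.app X) hX
  have hnat : P.IsClosedUnderColimitsOfShape (Discrete ℕ) :=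
    (hcoprod (ULift.{u} ℕ)).of_equivalence (Discrete.equivalence Equiv.ulift.{u})
  choose I Y f g h hT hY using fun (k : ℤ) (X : {X // vanishAbove E (-k) X}) =>
    hE.exists_approximation k X.2
  let B : ∀ k : ℕ, {X // vanishAbove E (-(k : ℤ)) X} := fun k =>
    Nat.rec ⟨A, by simpa using hA⟩ (fun k X => ⟨Y k X, by
      have := hY k X
      rwa [show -((k + 1 : ℕ) : ℤ) = -k - 1 by push_cast; ring]⟩) k
  let a : ∀ k : ℕ, (B k).1 ⟶ (B (k + 1)).1 := fun k => g k (B k)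
  have := isIso_telescope (fun k => (B k).1) a fun k => isLE_of_vanishAbove hLE (B k).2
  -- The telescope lemma yields (A 0)[1], so it is applied to the class of X with X[-1] in P.
  have hQ₂ : (P.shift (-1 : ℤ)).IsTriangulatedClosed₂ :=
    ⟨fun T hT h₁ h₃ => ObjectProperty.le_isoClosure _ _
      (P.ext_of_isTriangulatedClosed₂ _ (Triangle.shift_distinguished _ hT (-1)) h₁ h₃)⟩
  have hQ₀ : (P.shift (-1 : ℤ)).ContainsZero := by
    have := hcoprod PEmpty.{u + 1}
    let Z : DerivedCategory (ModuleCat.{u} S) := ∐ PEmpty.elim.{u + 2, u + 1}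
    have hZ : IsZero Z := (IsZero.iff_id_eq_zero _).2 (Sigma.hom_ext _ _ fun j => j.elim)
    exact ⟨Z, hZ, P.prop_of_iso (hZ.iso ((shiftFunctor _ (-1 : ℤ)).map_isZero hZ))
      (P.prop_colimit _ fun j => j.as.elim)⟩
  have key : (P.shift (-1 : ℤ)) (((B 0).1)⟦(1 : ℤ)⟧) := by
    refine prop_shift_of_isIso_telescope (P.shift (-1 : ℤ)) (fun X hX => ?_) (fun X hX => ?_)
      (fun k => (B k).1) a (fun k => ?_)
    · exact P.prop_of_iso ((shiftFunctorComm _ (-1 : ℤ) (1 : ℤ)).app X)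
        (hshift one_pos.le _ hX)
    · exact P.prop_of_isColimit (isColimitShiftCofan X (-1)) fun j => hX j.as
    -- The cone of `a k` is a copower of E shifted by k + 1; undoing one shift leaves the
    -- nonnegative shift k.
    · refine ⟨_, _, _, rot_of_distTriang _ (hT k (B k)), ?_⟩
      refine P.prop_of_iso ((shiftEquiv _ (1 : ℤ)).unitIso.app _) (hshift (by lia) _ ?_)
      have := hcoprod (I k (B k))
      exact P.prop_colimit _ fun _ => hPE
  exact P.prop_of_iso ((shiftEquiv _ (1 : ℤ)).unitIso.symm.app _) key

end Generation

/-! ### Modules inside the derived category -/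

section Modules

variable {S : Type u} [Ring S] [HasDerivedCategory.{w} (ModuleCat.{u} S)]

open DerivedCategory

lemma Q_map_surjective_of_isKProjective (K L : CochainComplex (ModuleCat.{u} S) ℤ)
    [K.IsKProjective] : Function.Surjective (Q.map : (K ⟶ L) → (Q.obj K ⟶ Q.obj L)) := by
  intro f
  obtain ⟨g, hg⟩ := (CochainComplex.IsKProjective.Qh_map_bijective K
    ((HomotopyCategory.quotient _ _).obj L)).surjective
    ((quotientCompQhIso _).hom.app K ≫ f ≫ (quotientCompQhIso _).inv.app L)
  obtain ⟨g, rfl⟩ := (HomotopyCategory.quotient _ _).map_surjective g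
  refine ⟨g, ?_⟩
  rw [← cancel_epi ((quotientCompQhIso _).hom.app K), ← quotientCompQhIso_hom_naturality, hg]
  simp

/-- Morphisms from a module to an object of the derived category form a small set. -/
lemma small_single_hom (T : ModuleCat.{u} S) (A : DerivedCategory (ModuleCat.{u} S)) :
    Small.{u} ((singleFunctor _ 0).obj T ⟶ A) := by
  let P := projectiveResolution T
  have : QuasiIso P.π' := inferInstance
  let e₀ := asIso (Q.map P.π')
  let e : Q.obj P.cochainComplex ≅ (singleFunctor _ 0).obj T := e₀
  let a : Q.obj (Q.objPreimage A) ≅ A := Q.objObjPreimageIso A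
  refine small_of_surjective.{u} (α := P.cochainComplex ⟶ Q.objPreimage A)
    (f := fun g => e.inv ≫ Q.map g ≫ a.hom) fun f => ?_
  obtain ⟨g, hg⟩ := Q_map_surjective_of_isKProjective _ _ (e.hom ≫ f ≫ a.inv)
  exact ⟨g, by simp [hg]⟩

/-- P in degree 0 is K-projective, so f comes from a chain map into a complex that is zero in degree
0. -/
lemma single_projective_hom_eq_zero (P : ModuleCat.{u} S) [Projective P]
    (A : DerivedCategory (ModuleCat.{u} S)) (hA : A.IsLE (-1))
    (f : (singleFunctor _ 0).obj P ⟶ A) : f = 0 := by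
  obtain ⟨K, hK, ⟨e⟩⟩ := A.exists_iso_Q_obj_of_isLE (-1)
  let L : CochainComplex (ModuleCat.{u} S) ℤ :=
    (HomologicalComplex.single (ModuleCat.{u} S) (ComplexShape.up ℤ) 0).obj P
  have : ∀ n, Projective (L.X n) := fun n => by
    by_cases hn : n = 0
    · subst hn
      exact Projective.of_iso (HomologicalComplex.singleObjXSelf (ComplexShape.up ℤ) 0 P).symm
        inferInstance
    · have hz : IsZero (L.X n) := HomologicalComplex.isZero_single_obj_X _ _ _ _ hn
      exact ⟨fun _ _ _ => ⟨0, hz.eq_of_src _ _⟩⟩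
  have : L.IsStrictlyLE 0 := by
    rw [CochainComplex.isStrictlyLE_iff]
    exact fun i hi => HomologicalComplex.isZero_single_obj_X _ _ _ _ (by lia)
  have : L.IsKProjective := CochainComplex.isKProjective_of_projective L 0
  obtain ⟨g, hg⟩ := Q_map_surjective_of_isKProjective L K (f ≫ e.hom)
  have hg' : g = 0 := by
    refine HomologicalComplex.hom_ext _ _ fun n => ?_
    by_cases hn : n = 0
    · subst hn
      exact (K.isZero_of_isStrictlyLE (-1) 0 (by lia)).eq_of_tgt _ _
    · exact (HomologicalComplex.isZero_single_obj_X _ _ _ _ hn).eq_of_src _ _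
  refine (cancel_mono e.hom).1 ?_
  rw [zero_comp]
  refine hg.symm.trans ?_
  rw [hg', Functor.map_zero]
  rfl

lemma hom_shift_eq_zero {X Y : DerivedCategory (ModuleCat.{u} S)} {a b : ℤ} (hab : a + b = 0)
    (h : ∀ f : X ⟶ Y⟦b⟧, f = 0) (f : X⟦a⟧ ⟶ Y) : f = 0 := by
  apply (shiftFunctor _ b).map_injective
  rw [Functor.map_zero, ← cancel_epi ((shiftFunctorCompIsoId _ a b hab).inv.app X), comp_zero]
  exact h _

section ShortExact

variable {SC : ShortComplex (ModuleCat.{u} S)}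

/-- Projective dimension of the cokernel in a short exact sequence. -/
lemma single_hom_eq_zero_of_shortExact (hS : SC.ShortExact) {d : ℤ}
    (h₁ : ∀ A : DerivedCategory (ModuleCat.{u} S), A.IsLE (-d) →
      ∀ f : (singleFunctor _ 0).obj SC.X₁ ⟶ A, f = 0)
    (h₂ : ∀ A : DerivedCategory (ModuleCat.{u} S), A.IsLE (-d - 1) →
      ∀ f : (singleFunctor _ 0).obj SC.X₂ ⟶ A, f = 0)
    (A : DerivedCategory (ModuleCat.{u} S)) (hA : A.IsLE (-d - 1))
    (f : (singleFunctor _ 0).obj SC.X₃ ⟶ A) : f = 0 := by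
  -- What remains is a map X₁[1] → A, that is X₁ → A[-1], whose target lies in degrees ≤ -d.
  obtain ⟨b, rfl⟩ := exists_desc₃ hS.singleTriangle_distinguished f (h₂ A hA _)
  have : b = 0 := hom_shift_eq_zero (a := 1) (b := -1) (by lia)
    (h₁ _ (TStructure.t.isLE_shift A (-d - 1) (-1) (-d))) b
  rw [this, comp_zero]

/-- The kernel of an epimorphism between modules which are orthogonal to the positive shifts of
`A` has the same property. -/
lemma vanishAbove_single_of_shortExact (hS : SC.ShortExact)
    {A : DerivedCategory (ModuleCat.{u} S)}
    (h₂ : vanishAbove ((singleFunctor _ 0).obj SC.X₂) 0 A)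
    (h₃ : vanishAbove ((singleFunctor _ 0).obj SC.X₃) 0 A) :
    vanishAbove ((singleFunctor _ 0).obj SC.X₁) 0 A := by
  intro j hj f
  apply (shiftFunctor _ (1 : ℤ)).map_injective
  obtain ⟨b, hb⟩ := exists_desc₁ hS.singleTriangle_distinguished (f⟦(1 : ℤ)⟧')
    (vanishAbove_shift _ (a := j) (l := -j) (by lia) h₃ 1 (by lia) _)
  obtain ⟨c, rfl⟩ := (shiftFunctor _ (1 : ℤ)).map_surjective b
  rw [hb, h₂ j hj c, Functor.map_zero, comp_zero, Functor.map_zero]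

end ShortExact

/-- An object without morphisms from the regular module to its positive shifts has cohomology
only in nonpositive degrees. -/
lemma isLE_of_vanishAbove_single {A : DerivedCategory (ModuleCat.{u} S)}
    (hA : vanishAbove ((singleFunctor _ 0).obj (ModuleCat.of S S)) 0 A) : A.IsLE 0 := by
  let K := Q.objPreimage A
  let e : Q.obj K ≅ A := Q.objObjPreimageIso A
  rw [isLE_iff]
  intro i hi
  refine IsZero.of_iso ?_ ((homologyFunctor _ i).mapIso e.symm ≪≫ (homologyFunctorFactors _ i).app K)
  change IsZero (K.homology i)
  have hz : ∀ z : K.homology i, z = 0 := by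
    intro z
    obtain ⟨c, rfl⟩ := (ModuleCat.epi_iff_surjective (K.homologyπ i)).1 inferInstance z
    -- The cocycle c is the image of 1 under a chain map from S in degree i; this map vanishes in
    -- the derived category, so the class of c is zero.
    let φ : ModuleCat.of S S ⟶ K.X i :=
      ModuleCat.ofHom (LinearMap.toSpanSingleton S (K.X i) (K.iCycles i c))
    have hφ : ∀ k, (ComplexShape.up ℤ).Rel i k → φ ≫ K.d i k = 0 := by
      intro k _
      ext
      change K.d i k ((1 : S) • K.iCycles i c) = 0
      rw [one_smul]
      exact ConcreteCategory.congr_hom (K.iCycles_d i k) c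
    let Φ : (HomologicalComplex.single (ModuleCat.{u} S) (ComplexShape.up ℤ) i).obj
        (ModuleCat.of S S) ⟶ K := HomologicalComplex.mkHomFromSingle φ hφ
    have hΦ : Q.map Φ = 0 := by
      let s : ((singleFunctor (ModuleCat.{u} S) 0).obj (ModuleCat.of S S))⟦-i⟧ ≅
          (singleFunctor (ModuleCat.{u} S) i).obj (ModuleCat.of S S) :=
        ((singleFunctors (ModuleCat.{u} S)).shiftIso (-i) i 0 (by lia)).app _
      have hs : s.hom ≫ (Q.map Φ ≫ e.hom) = 0 :=
        hom_shift_eq_zero (a := -i) (b := i) (by lia) (hA i hi) _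
      have := (cancel_epi s.hom).1 (hs.trans comp_zero.symm)
      exact (cancel_mono e.hom).1 (this.trans zero_comp.symm)
    have hΦ' : HomologicalComplex.homologyMap Φ i = 0 := by
      refine (cancel_epi ((homologyFunctorFactors (ModuleCat.{u} S) i).hom.app _)).1 ?_
      refine (homologyFunctorFactors_hom_naturality Φ i).symm.trans ?_
      rw [hΦ, Functor.map_zero, zero_comp]
      exact comp_zero.symm
    let c' := (HomologicalComplex.singleObjCyclesSelfIso (ComplexShape.up ℤ) i
      (ModuleCat.of S S)).inv (1 : S)
    have hc' : HomologicalComplex.cyclesMap Φ i c' = c := by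
      apply (ModuleCat.mono_iff_injective (K.iCycles i)).1 inferInstance
      have h₁ : (HomologicalComplex.singleObjCyclesSelfIso (ComplexShape.up ℤ) i
          (ModuleCat.of S S)).inv ≫ HomologicalComplex.cyclesMap Φ i ≫ K.iCycles i = φ := by
        simp [Φ]
      have h₂ := ConcreteCategory.congr_hom h₁ (1 : S)
      refine h₂.trans ?_
      exact one_smul S _
    have h := ConcreteCategory.congr_hom (HomologicalComplex.homologyπ_naturality Φ i) c'
    rw [hΦ', comp_zero] at h
    have h' : K.homologyπ i (HomologicalComplex.cyclesMap Φ i c') = 0 := h.symm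
    rwa [hc'] at h'
  have : Subsingleton (K.homology i) := ⟨fun a b => (hz a).trans (hz b).symm⟩
  exact ModuleCat.isZero_of_subsingleton _

section Coproducts

variable {J : Type u}

instance preservesCoproducts_Q :
    PreservesColimitsOfShape (Discrete J)
      (Q : CochainComplex (ModuleCat.{u} S) ℤ ⥤ DerivedCategory (ModuleCat.{u} S)) := by
  have : ∀ K : J → CochainComplex (ModuleCat.{u} S) ℤ, PreservesColimit (Discrete.functor K)
      (Q : CochainComplex (ModuleCat.{u} S) ℤ ⥤ DerivedCategory (ModuleCat.{u} S)) := fun K =>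
    preservesColimit_of_preserves_colimit_cocone (coproductIsCoproduct K)
      ((Cofan.isColimitMapCoconeEquiv _ _ _).symm (isColimitQSigma K))
  exact ⟨fun {F} => preservesColimit_of_iso_diagram _ Discrete.natIsoFunctor.symm⟩

instance preservesCoproducts_singleFunctor (n : ℤ) :
    PreservesColimitsOfShape (Discrete J) (singleFunctor (ModuleCat.{u} S) n) :=
  preservesColimitsOfShape_of_natIso (F := HomologicalComplex.single _ _ n ⋙ Q) (Iso.refl _)

/-- Finitely supported functions form a coproduct of modules. -/
noncomputable def isColimitFinsupp (T : ModuleCat.{u} S) :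
    IsColimit (Cofan.mk (ModuleCat.of S (J →₀ T))
      (fun j => ModuleCat.ofHom (Finsupp.lsingle j)) : Cofan fun _ : J => T) :=
  Cofan.IsColimit.mk _ (fun t => ModuleCat.ofHom (Finsupp.lsum ℕ fun j => (t.inj j).hom))
    (fun t j => by
      ext x
      exact Finsupp.sum_single_index (map_zero (t.inj j).hom))
    (fun t m hm => by
      ext : 1
      refine Finsupp.lhom_ext fun j x => ?_
      refine (ConcreteCategory.congr_hom (hm j) x).trans ?_
      exact (Finsupp.sum_single_index (h := fun k y => (t.inj k).hom y) (map_zero _)).symm)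

end Coproducts

end Modules

/-! ### Splitting long exact sequences -/

section Images

open ComposableArrows

variable {R : Type u} [Ring R] {n : ℕ} {X : ComposableArrows (ModuleCat.{u} Rᵐᵒᵖ) (n + 1)}

/-- The images of the maps in an exact sequence `0 ⟶ X₀ ⟶ ⋯ ⟶ Xₙ₊₁ ⟶ 0` split it into short exact
sequences. -/
lemma IsExactWithZeros.exists_images (hX : IsExactWithZeros X) :
    ∃ I : ∀ i : ℕ, i ≤ n → ModuleCat.{u} Rᵐᵒᵖ,
      Nonempty (X.obj 0 ≅ I 0 (Nat.zero_le n)) ∧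
      Nonempty (I n le_rfl ≅ X.obj (Fin.last (n + 1))) ∧
      ∀ (i : ℕ) (hi : i < n), ∃ (f : I i hi.le ⟶ X.obj ⟨i + 1, by lia⟩)
        (g : X.obj ⟨i + 1, by lia⟩ ⟶ I (i + 1) hi) (w : f ≫ g = 0),
        (ShortComplex.mk f g w).ShortExact := by
  refine ⟨fun i hi => image (X.map' i (i + 1) (by lia) (by lia)), ?_, ?_, fun i hi => ?_⟩
  · let a := X.map' 0 (0 + 1) (Nat.le_succ 0) (Nat.le_add_left 1 n)
    have : Mono a := hX.mono
    have : Mono (factorThruImage a) := mono_of_mono_fac (image.fac a)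
    have : IsIso (factorThruImage a) := isIso_of_mono_of_epi _
    let e := asIso (factorThruImage a)
    exact ⟨e⟩
  · let a := X.map' n (n + 1) (Nat.le_succ n) le_rfl
    have : Epi a := hX.epi
    have : Epi (image.ι a) := epi_of_epi_fac (image.fac a)
    have : IsIso (image.ι a) := isIso_of_mono_of_epi _
    exact ⟨asIso (image.ι a)⟩
  · let a := X.map' i (i + 1) (by lia) (by lia)
    let b := X.map' (i + 1) (i + 2) (by lia) (by lia)
    have w : a ≫ b = 0 := hX.exact.zero i (by lia)
    have hab : (ShortComplex.mk a b w).Exact := hX.exact.exact i (by lia)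
    have w₁ : image.ι a ≫ b = 0 := by
      rw [← cancel_epi (factorThruImage a), image.fac_assoc, w, comp_zero]
    have w₂ : image.ι a ≫ factorThruImage b = 0 := by
      rw [← cancel_mono (image.ι b), Category.assoc, image.fac, w₁, zero_comp]
    let φ : ShortComplex.mk a b w ⟶ ShortComplex.mk (image.ι a) b w₁ :=
      { τ₁ := factorThruImage a
        τ₂ := 𝟙 _
        τ₃ := 𝟙 _ }
    let ψ : ShortComplex.mk (image.ι a) (factorThruImage b) w₂ ⟶
        ShortComplex.mk (image.ι a) b w₁ :=
      { τ₁ := 𝟙 _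
        τ₂ := 𝟙 _
        τ₃ := image.ι b }
    have : Epi φ.τ₁ := inferInstanceAs (Epi (factorThruImage a))
    have : IsIso φ.τ₂ := inferInstanceAs (IsIso (𝟙 _))
    have : Mono φ.τ₃ := inferInstanceAs (Mono (𝟙 _))
    have : Epi ψ.τ₁ := inferInstanceAs (Epi (𝟙 _))
    have : IsIso ψ.τ₂ := inferInstanceAs (IsIso (𝟙 _))
    have : Mono ψ.τ₃ := inferInstanceAs (Mono (image.ι b))
    refine ⟨image.ι a, factorThruImage b, w₂, ?_⟩
    exact
      { exact := (ShortComplex.exact_iff_of_epi_of_isIso_of_mono ψ).2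
          ((ShortComplex.exact_iff_of_epi_of_isIso_of_mono φ).1 hab)
        mono_f := inferInstanceAs (Mono (image.ι a))
        epi_g := inferInstanceAs (Epi (factorThruImage b)) }

end Images

/-! ### Tilting modules -/

section Tilting

open DerivedCategory

variable {R : Type u} [Ring R] [HasDerivedCategory.{w} (ModuleCat.{u} Rᵐᵒᵖ)] {n : ℕ}
  {T : ModuleCat.{u} Rᵐᵒᵖ}

/-- The direct sum `T^(I)` is the coproduct of copies of `T` in the derived category. -/
lemma nonempty_single_copower_iso (T : ModuleCat.{u} Rᵐᵒᵖ) (I : Type u) :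
    Nonempty ((singleFunctor _ 0).obj (copower T I) ≅ ∐ fun _ : I => (singleFunctor _ 0).obj T) :=
  ⟨(Cofan.isColimitMapCoconeEquiv _ _ _
      (isColimitOfPreserves (singleFunctor _ 0) (isColimitFinsupp (J := I) T))).coconePointUniqueUpToIso
    (coproductIsCoproduct _)⟩

lemma IsTilting.vanishAbove_copower (hT : IsTilting n T) (I : Type u) :
    vanishAbove ((singleFunctor _ 0).obj T) 0 ((singleFunctor _ 0).obj (copower T I)) := by
  intro j hj f
  obtain ⟨m, rfl⟩ := Int.eq_ofNat_of_zero_le hj.le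
  have h := hT.ext_eq_zero m (by lia) I (Abelian.Ext.homEquiv.symm f)
  have h' := congr_arg Abelian.Ext.hom h
  rw [Abelian.Ext.zero_hom] at h'
  exact (Abelian.Ext.homEquiv.apply_symm_apply f).symm.trans h'

lemma IsTilting.isPresilting (hT : IsTilting n T) :
    IsPresilting.{w, u} ((singleFunctor (ModuleCat.{u} Rᵐᵒᵖ) 0).obj T) where
  small A := small_single_hom T A
  vanish I := (vanishAbove _ 0).prop_of_iso (nonempty_single_copower_iso T I).some
    (hT.vanishAbove_copower I)

lemma IsTilting.vanishAbove_self (hT : IsTilting n T) :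
    vanishAbove ((singleFunctor _ 0).obj T) 0 ((singleFunctor _ 0).obj T) :=
  vanishAbove_of_retract _ (Sigma.ι (fun _ : PUnit.{u + 1} => (singleFunctor _ 0).obj T) PUnit.unit)
    (Sigma.desc fun _ => 𝟙 _) (by simp) (hT.isPresilting.vanish PUnit)

/-- The length of the projective resolution bounds the projective dimension. -/
lemma IsTilting.single_hom_eq_zero (hT : IsTilting n T) (A : D.{w} R) (hA : A.IsLE (-n - 1))
    (f : (singleFunctor _ 0).obj T ⟶ A) : f = 0 := by
  obtain ⟨X, hX, hproj, ⟨e⟩⟩ := hT.resolution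
  obtain ⟨I, ⟨e₀⟩, ⟨e₁⟩, hI⟩ := hX.exists_images
  -- By induction, the i-th image has projective dimension at most i.
  have key : ∀ (i : ℕ) (hi : i ≤ n) (A : D.{w} R), A.IsLE (-i - 1) →
      ∀ f : (singleFunctor _ 0).obj (I i hi) ⟶ A, f = 0 := by
    intro i
    induction i with
    | zero =>
      intro hi A hA f
      have : Projective (I 0 hi) := Projective.of_iso e₀ (hproj 0)
      exact single_projective_hom_eq_zero _ A (by simpa using hA) f
    | succ i ih =>
      intro hi A hA f
      obtain ⟨a, b, w, hS⟩ := hI i hi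
      refine single_hom_eq_zero_of_shortExact hS (d := i + 1) (fun A hA f => ?_)
        (fun A hA f => ?_) A (by simpa using hA) f
      · exact ih _ A (by rwa [show -(i : ℤ) - 1 = -(i + 1) by ring]) f
      · have : Projective (X.obj ⟨i + 1, by lia⟩) := hproj ⟨i + 1, by lia⟩
        have : A.IsLE (-1) := TStructure.t.isLE_of_le A (-(i + 1) - 1) (-1) (by lia)
        exact single_projective_hom_eq_zero _ A this f
  have := key n le_rfl A hA ((singleFunctor _ 0).map (e₁.hom ≫ e.hom) ≫ f)
  rw [← cancel_epi ((singleFunctor _ 0).map (e₁.hom ≫ e.hom)), this, comp_zero]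

lemma IsTilting.vanishAbove_of_isLE (hT : IsTilting n T) (A : D.{w} R) (hA : A.IsLE (-n)) :
    vanishAbove ((singleFunctor _ 0).obj T) 0 A := by
  intro j hj f
  have : (A⟦j⟧).IsLE (-n - j) := TStructure.t.isLE_shift A (-n) j (-n - j)
  exact hT.single_hom_eq_zero _ (TStructure.t.isLE_of_le (A⟦j⟧) (-n - j) (-n - 1) (by lia)) f

/-- Hom(-, A[j]) turns coproducts into products and respects retracts. -/
lemma vanishAbove_single_of_isSummandOfCopower {M : ModuleCat.{u} Rᵐᵒᵖ}
    (hM : IsSummandOfCopower T M) {A : D.{w} R}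
    (hA : vanishAbove ((singleFunctor _ 0).obj T) 0 A) :
    vanishAbove ((singleFunctor _ 0).obj M) 0 A := by
  intro j hj f
  obtain ⟨I, N, ⟨φ⟩⟩ := hM
  let i : M ⟶ copower T I := ModuleCat.ofHom (φ.toLinearMap ∘ₗ LinearMap.inl _ M N)
  let r : copower T I ⟶ M := ModuleCat.ofHom (LinearMap.fst _ M N ∘ₗ φ.symm.toLinearMap)
  have hir : i ≫ r = 𝟙 M := by
    ext x
    simp [i, r]
  obtain ⟨e⟩ := nonempty_single_copower_iso T I
  have h : (singleFunctor _ 0).map r ≫ f = 0 := by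
    rw [← cancel_epi e.inv, comp_zero]
    refine Sigma.hom_ext _ _ fun k => ?_
    rw [comp_zero]
    exact hA j hj _
  calc
    f = (singleFunctor _ 0).map (𝟙 M) ≫ f := by
      rw [CategoryTheory.Functor.map_id]
      exact (Category.id_comp f).symm
    _ = (singleFunctor _ 0).map i ≫ (singleFunctor _ 0).map r ≫ f := by
      rw [← hir, Functor.map_comp, Category.assoc]
    _ = 0 := by rw [h, comp_zero]

/-- The coresolution of the ring forces the right orthogonal into nonpositive degrees. -/
lemma IsTilting.isLE_of_vanishAbove (hT : IsTilting n T) (A : D.{w} R)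
    (hA : vanishAbove ((singleFunctor _ 0).obj T) 0 A) : A.IsLE 0 := by
  obtain ⟨X, hX, ⟨e⟩, hsum⟩ := hT.coresolution
  obtain ⟨I, ⟨e₀⟩, ⟨e₁⟩, hI⟩ := hX.exists_images
  have hiso : ∀ {M N : ModuleCat.{u} Rᵐᵒᵖ} (_ : M ≅ N),
      vanishAbove ((singleFunctor _ 0).obj N) 0 A → vanishAbove ((singleFunctor _ 0).obj M) 0 A := by
    intro M N i hN j hj f
    rw [← cancel_epi ((singleFunctor _ 0).map i.inv), comp_zero]
    exact hN j hj _
  -- Induction on the distance k to the right end: orthogonality passes from Tₙ down to R through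
  -- the kernels.
  have key : ∀ (k i : ℕ) (hi : i + k = n),
      vanishAbove ((singleFunctor _ 0).obj (I i (by lia))) 0 A := by
    intro k
    induction k with
    | zero =>
      rintro i rfl
      exact hiso e₁ (vanishAbove_single_of_isSummandOfCopower (hsum (Fin.last _)) hA)
    | succ k ih =>
      intro i hi
      obtain ⟨a, b, w, hS⟩ := hI i (by lia)
      exact vanishAbove_single_of_shortExact hS
        (vanishAbove_single_of_isSummandOfCopower (hsum ⟨i, by lia⟩) hA) (ih (i + 1) (by lia))
  -- Identifies the regular module of the opposite ring with R as a right module.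
  let e₂ : Rᵐᵒᵖ ≃ₗ[Rᵐᵒᵖ] R :=
    { MulOpposite.opAddEquiv.symm with
      map_smul' := fun _ _ => rfl }
  exact isLE_of_vanishAbove_single
    (hiso (e₂.toModuleIso ≪≫ e.symm ≪≫ e₀) (key n 0 (by lia)))

/-- All three axioms meet here: (T2) reduces to V_{-n}, (T3) puts these objects in D^{≤ -n}, and
(T1) returns their coproduct to V_0. -/
lemma IsTilting.vanishAbove_isClosedUnderCoproducts (hT : IsTilting n T) (J : Type u) :
    (vanishAbove ((singleFunctor (ModuleCat.{u} Rᵐᵒᵖ) 0).obj T) 0).IsClosedUnderColimitsOfShape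
      (Discrete J) := by
  refine .mk' ?_
  rintro _ ⟨F, hF⟩
  refine (vanishAbove _ 0).prop_of_iso (HasColimit.isoOfNatIso Discrete.natIsoFunctor).symm
    (hT.isPresilting.vanishAbove_coproduct n (fun X hX => ?_) _ fun j => hF ⟨j⟩)
  exact hT.vanishAbove_of_isLE _
    (isLE_sigma X _ fun j => TiltingAisle.isLE_of_vanishAbove hT.isLE_of_vanishAbove (hX j))

lemma isSuspended_vanishAbove (E : D.{w} R) : IsSuspended (vanishAbove E 0) where
  iso := inferInstance
  ext := inferInstance
  shift j hj := ⟨fun _ hA => vanishAbove_mono E (by lia) _ (vanishAbove_shift E (l := -j) (by lia) hA)⟩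

end Tilting

end TiltingAisle

theorem lemma2p2 {R : Type u} [Ring R] [HasDerivedCategory.{w} (ModuleCat.{u} Rᵐᵒᵖ)]
    (n : ℕ) (T : ModuleCat.{u} Rᵐᵒᵖ) (hT : TiltingAisle.IsTilting n T) :
    TiltingAisle.susp ((DerivedCategory.singleFunctor (ModuleCat.{u} Rᵐᵒᵖ) 0).obj T) =
      fun A : TiltingAisle.D.{w} R => ∀ j : ℤ, 0 < j →
        ∀ f : (DerivedCategory.singleFunctor (ModuleCat.{u} Rᵐᵒᵖ) 0).obj T ⟶ A⟦j⟧, f = 0 := by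
  funext A
  refine propext ⟨fun h => ?_, fun h P hP hcoprod hPT => ?_⟩
  · exact h (TiltingAisle.vanishAbove _ 0) (TiltingAisle.isSuspended_vanishAbove _)
      hT.vanishAbove_isClosedUnderCoproducts hT.vanishAbove_self
  · exact hT.isPresilting.prop_of_vanishAbove hT.isLE_of_vanishAbove P hP hcoprod hPT h
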